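/- All graphs are finite and simple; the order of a graph is its number of vertices. A cummerbund of a graph is a longest cycle in it, and the cummerbund covering number ${\rm cc}(G)$ of a graph $G$ is the number of vertices of $G$ that lie in at least one cummerbund. A graph is $k$-connected if it has more than $k$ vertices and remains connected after the deletion of any fewer than $k$ vertices. Let $k\ge 2$ and $n>k$ be integers. Then the minimum of ${\rm cc}(G)$ over all $k$-connected graphs $G$ of order $n$ is $\min\{n,3k\}$; that is, every $k$-connected graph $G$ of order $n$ satisfies ${\rm cc}(G)\ge\min\{n,3k\}$, and equality holds for at least one such graph. Moreover, if $n>3k$, then the graph $kK_1\vee (kK_2+(n-3k)K_1)$ is a $k$-connected graph of order $n$ whose cummerbund covering number is $3k=\min\{n,3k\}$. Here $K_m$ is the complete graph of order $m$, $qH$ is the disjoint union of $q$ copies of $H$, $G+H$ is the disjoint union of $G$ and $H$, and $G\vee H$ is obtained from $G+H$ by joining every vertex of $G$ to every vertex of $H$ by an edge. -/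

import Mathlib

universe u

namespace Cummerbund

/-- `G` is `k`-connected: it has more than `k` vertices, and deleting fewer than `k` vertices
always leaves a connected graph. -/
def IsKConnected {V : Type*} [Fintype V] (G : SimpleGraph V) (k : ℕ) : Prop :=
  k < Fintype.card V ∧ ∀ S : Finset V, S.card < k → (G.induce {v | v ∉ S}).Connected

/-- A cummerbund is a longest cycle. -/
def IsCummerbund {V : Type*} (G : SimpleGraph V) {u : V} (c : G.Walk u u) : Prop :=
  c.IsCycle ∧ ∀ (w : V) (d : G.Walk w w), d.IsCycle → d.length ≤ c.length

/-- The cummerbund covering number: the number of vertices that lie in a cummerbund. -/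
noncomputable def cc {V : Type*} (G : SimpleGraph V) : ℕ :=
  {v : V | ∃ (u : V) (c : G.Walk u u), IsCummerbund G c ∧ v ∈ c.support}.ncard

/-- `copies q H` is the disjoint union of `q` copies of `H`. -/
def copies {V : Type*} (q : ℕ) (H : SimpleGraph V) : SimpleGraph (Fin q × V) where
  Adj x y := x.1 = y.1 ∧ H.Adj x.2 y.2
  symm := ⟨fun _ _ h => ⟨h.1.symm, h.2.symm⟩⟩
  loopless := ⟨fun _ h => H.irrefl h.2⟩

/-- The join of `G` and `H`: the disjoint union together with all edges between `G` and `H`. -/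
def join {V W : Type*} (G : SimpleGraph V) (H : SimpleGraph W) : SimpleGraph (V ⊕ W) :=
  (G ⊕g H) ⊔ completeBipartiteGraph V W

/-- The complete graph on `m` vertices. -/
abbrev K (m : ℕ) : SimpleGraph (Fin m) := ⊤

/-- The graph `k K₁ ∨ (k K₂ + s K₁)`. -/
def extremalGraph (k s : ℕ) :
    SimpleGraph ((Fin k × Fin 1) ⊕ ((Fin k × Fin 2) ⊕ (Fin s × Fin 1))) :=
  join (copies k (K 1)) (copies k (K 2) ⊕g copies s (K 1))

end Cummerbund

/-! Lower bound. If every vertex lies on a longest cycle, then cc = n. Otherwise some v is missed by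
all of them. Take a longest cycle of length L and a fan of k paths from v to it
(`IsKConnected.exists_fan`). If two ends of the fan were at distance d ≤ 2 along the cycle,
replacing that arc by the detour through v, of length at least 2, would give a cycle of length at
least L through v, hence a longest one. So the ends are at least 3 apart, and 3k ≤ L ≤ cc.

Upper bound. For n ≤ 3k the complete graph serves. For n > 3k, let A be the k independent vertices
of the extremal graph. Its complement induces components of order at most 2, so three consecutive
vertices of a cycle meet A and no cycle is longer than 3k. A cycle through an isolated vertex of the
complement has two members of A only two steps apart, and so is shorter than 3k
(`IsCyclicTrace.length_lt`). As a cycle of length 3k exists, longest cycles avoid the isolated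
vertices, leaving at most 3k covered ones. -/

namespace Cummerbund

/-! ### Fans from Hall's theorem. -/

open Finset in
/-- Hall's theorem turns `k`-connectedness into a transversal that threads `m` disjoint routes
from `v` to `C`. -/
lemma IsKConnected.exists_transversal {V : Type*} [Fintype V] {G : SimpleGraph V} {k : ℕ}
    (hG : IsKConnected G k) {C : Finset V} {v : V} (hv : v ∉ C) {m : ℕ} (hmk : m ≤ k)
    (hmC : m ≤ #C) :
    ∃ f : Fin m ⊕ {w : V // w ≠ v ∧ w ∉ C} → V, Function.Injective f ∧ (∀ a, f a ≠ v) ∧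
      (∀ i, G.Adj v (f (.inl i))) ∧ ∀ w, f (.inr w) = w ∨ G.Adj w (f (.inr w)) := by
  classical
  let t : Fin m ⊕ {w : V // w ≠ v ∧ w ∉ C} → Finset V := Sum.elim
    (fun _ => univ.filter fun w => G.Adj v w)
    -- A vertex may represent itself, so that vertices on no route need no successor.
    (fun u => univ.filter fun w => w ≠ v ∧ (w = u ∨ G.Adj u w))
  have htv (a) : v ∉ t a := by rcases a with a | a <;> simp [t]
  have hall : ∀ s : Finset (Fin m ⊕ {w : V // w ≠ v ∧ w ∉ C}), #s ≤ #(s.biUnion t) := by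
    intro s
    let U : Finset V := s.toRight.map (Function.Embedding.subtype _)
    have hU : U ⊆ s.biUnion t := by
      intro w hw
      simp only [U, mem_map, mem_toRight, Function.Embedding.subtype_apply] at hw
      obtain ⟨a, ha, rfl⟩ := hw
      exact mem_biUnion.2 ⟨_, ha, by simpa [t] using a.2.1⟩
    have hcard : #s = #s.toLeft + #U := by
      rw [card_map, card_toLeft_add_card_toRight]
    rcases s.toLeft.eq_empty_or_nonempty with h0 | ⟨i, hi⟩
    · rw [hcard, h0, card_empty, zero_add]
      exact card_le_card hU
    have hleft : #s.toLeft ≤ m := (card_le_univ _).trans (by simp)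
    -- The set `B` separates `v` and `U` from the rest of the graph. If it had fewer than `m`
    -- elements, it would miss a vertex of `C` and could not disconnect the graph.
    suffices m ≤ #(s.biUnion t \ U) by
      rw [card_sdiff_of_subset hU] at this
      have := card_le_card hU
      omega
    by_contra! hlt
    set B := s.biUnion t \ U with hB
    obtain ⟨c, hcC, hcB⟩ := exists_mem_notMem_of_card_lt_card (hlt.trans_le hmC)
    have hvB : v ∉ B := by simp [hB, htv]
    obtain ⟨p⟩ := (hG.2 B (hlt.trans_le hmk)).preconnected ⟨v, hvB⟩ ⟨c, hcB⟩
    obtain ⟨d, -, hd1, hd2⟩ := p.exists_boundary_dart {w | w.1 = v ∨ w.1 ∈ U} (Or.inl rfl) (by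
      rintro (h | h)
      · exact hv (h ▸ hcC)
      · simp only [U, mem_map, Function.Embedding.subtype_apply] at h
        obtain ⟨a, -, rfl⟩ := h
        exact a.2.2 hcC)
    have hadj : G.Adj d.fst.1 d.snd.1 := d.adj
    simp only [Set.mem_ofPred_eq, not_or] at hd1 hd2
    refine d.snd.2 (mem_sdiff.2 ⟨mem_biUnion.2 ?_, hd2.2⟩)
    rcases hd1 with h | h
    · exact ⟨.inl i, mem_toLeft.1 hi, by simpa [t] using h ▸ hadj⟩
    · simp only [U, mem_map, mem_toRight, Function.Embedding.subtype_apply] at h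
      obtain ⟨a, ha, hae⟩ := h
      exact ⟨_, ha, by simpa [t, hae] using ⟨hd2.1, Or.inr hadj⟩⟩
  obtain ⟨f, hf, hft⟩ := (all_card_le_biUnion_card_iff_exists_injective t).1 hall
  refine ⟨f, hf, fun a h => htv a (h ▸ hft a), fun i => by simpa [t] using hft (.inl i),
    fun w => ?_⟩
  have := hft (.inr w)
  simp only [t, Sum.elim_inr, mem_filter_univ] at this
  exact this.2

/-- The fan lemma: in a `k`-connected graph, `m ≤ min k #C` paths from `v` to `C`, disjoint apart
from `v`, each meeting `C` only in its end. -/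
theorem IsKConnected.exists_fan {V : Type*} [Fintype V] {G : SimpleGraph V} {k : ℕ}
    (hG : IsKConnected G k) {C : Finset V} {v : V} (hv : v ∉ C) {m : ℕ} (hmk : m ≤ k)
    (hmC : m ≤ C.card) :
    ∃ (x : Fin m → V) (p : ∀ i, G.Walk v (x i)), (∀ i, (p i).IsPath) ∧ (∀ i, x i ∈ C) ∧
      (∀ i, ∀ w ∈ (p i).support, w ∈ C → w = x i) ∧
      ∀ i j, i ≠ j → ∀ w ∈ (p i).support, w ∈ (p j).support → w = v := by
  classical
  obtain ⟨f, hf, hfv, hfl, hfr⟩ := hG.exists_transversal hv hmk hmC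
  -- Iterating the successor map from the `m` chosen neighbours of `v` traces the routes. It is the
  -- identity on `C`, where a route stops.
  let F : V → V := fun w => if h : w ≠ v ∧ w ∉ C then f (.inr ⟨w, h⟩) else w
  have hF {w} (h : w ≠ v ∧ w ∉ C) : F w = f (.inr ⟨w, h⟩) := dif_pos h
  let o : Fin m → ℕ → V := fun i t => F^[t] (f (.inl i))
  have o_zero (i) : o i 0 = f (.inl i) := rfl
  have o_succ (i t) : o i (t + 1) = F (o i t) := Function.iterate_succ_apply' ..
  have o_ne (i t) : o i t ≠ v := by
    induction t with
    | zero => exact hfv _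
    | succ t ih =>
      rw [o_succ]
      by_cases h : o i t ∉ C
      · rw [hF ⟨ih, h⟩]; exact hfv _
      · rwa [show F (o i t) = o i t from dif_neg fun h' => h h'.2]
  have o_zero_ne (i j t) (h : o j t ∉ C) : o i 0 ≠ o j (t + 1) := by
    rw [o_succ, hF ⟨o_ne j t, h⟩, o_zero]
    exact fun h => by simpa using hf h
  have o_inj (i j s t) (hs : o i s ∉ C) (ht : o j t ∉ C) (h : o i (s + 1) = o j (t + 1)) :
      o i s = o j t := by
    rw [o_succ, o_succ, hF ⟨o_ne i s, hs⟩, hF ⟨o_ne j t, ht⟩] at h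
    simpa using hf h
  have hterm (i) : ∃ t, o i t ∈ C := by
    by_contra! hn
    -- Injectivity pulls a repetition back to the start of the orbit, which is a value at a left
    -- index and so no successor. Orbits that never meet `C` would thus be infinite.
    have key (s d) : o i s ≠ o i (s + d + 1) := by
      induction s with
      | zero => exact o_zero_ne i i _ (hn _)
      | succ s ih =>
        intro h
        rw [show s + 1 + d + 1 = (s + d + 1) + 1 by ring] at h
        exact ih (o_inj i i _ _ (hn _) (hn _) h)
    refine not_injective_infinite_finite (o i) fun s t hst => ?_
    rcases lt_trichotomy s t with h | h | h
    · obtain ⟨d, rfl⟩ := Nat.exists_eq_add_of_lt h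
      exact (key _ _ hst).elim
    · exact h
    · obtain ⟨d, rfl⟩ := Nat.exists_eq_add_of_lt h
      exact (key _ _ hst.symm).elim
  let T (i) : ℕ := Nat.find (hterm i)
  have hT (i) : o i (T i) ∈ C := Nat.find_spec (hterm i)
  have hlt (i t) (h : t < T i) : o i t ∉ C := Nat.find_min (hterm i) h
  have hdisj (i j) (hij : i ≠ j) (s t) (hs : s ≤ T i) (ht : t ≤ T j) : o i s ≠ o j t := by
    induction s generalizing t with
    | zero =>
      cases t with
      | zero => exact fun h => hij (by simpa using hf h)
      | succ t => exact o_zero_ne i j t (hlt j t ht)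
    | succ s ih =>
      cases t with
      | zero => exact (o_zero_ne j i s (hlt i s hs)).symm
      | succ t =>
        exact fun h => ih t (by omega) (by omega) (o_inj i j s t (hlt i s hs) (hlt j t ht) h)
  have hwalk (i t) (ht : t ≤ T i) :
      ∃ p : G.Walk v (o i t), ∀ w ∈ p.support, w = v ∨ ∃ s ≤ t, w = o i s := by
    induction t with
    | zero =>
      have hadj : G.Adj v (o i 0) := hfl i
      refine ⟨hadj.toWalk, fun w hw => ?_⟩
      rw [SimpleGraph.Adj.support_toWalk] at hw
      simp only [List.mem_cons, List.not_mem_nil, or_false] at hw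
      exact hw.imp id fun h => ⟨0, le_rfl, h⟩
    | succ t ih =>
      obtain ⟨p, hp⟩ := ih (by omega)
      have hstep : o i (t + 1) = o i t ∨ G.Adj (o i t) (o i (t + 1)) := by
        rw [o_succ, hF ⟨o_ne i t, hlt i t ht⟩]
        exact hfr _
      rcases hstep with h | h
      · refine ⟨p.copy rfl h.symm, fun w hw => ?_⟩
        rw [SimpleGraph.Walk.support_copy] at hw
        exact (hp w hw).imp id fun ⟨s, hs, h⟩ => ⟨s, by omega, h⟩
      · refine ⟨p.concat h, fun w hw => ?_⟩
        rw [SimpleGraph.Walk.support_concat, List.mem_append, List.mem_singleton] at hw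
        rcases hw with hw | hw
        · exact (hp w hw).imp id fun ⟨s, hs, h⟩ => ⟨s, by omega, h⟩
        · exact Or.inr ⟨_, le_rfl, hw⟩
  choose p hp using fun i => hwalk i (T i) le_rfl
  have hp' (i) (w) (hw : w ∈ (p i).bypass.support) : w = v ∨ ∃ s ≤ T i, w = o i s :=
    hp i w ((p i).support_bypass_subset_support hw)
  refine ⟨fun i => o i (T i), fun i => (p i).bypass, fun i => (p i).bypass_isPath, hT, ?_, ?_⟩
  · intro i w hw hC
    rcases hp' i w hw with rfl | ⟨s, hs, rfl⟩
    · exact (hv hC).elim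
    · rcases hs.lt_or_eq with h | rfl
      · exact (hlt i s h hC).elim
      · rfl
  · intro i j hij w hi hj
    rcases hp' i w hi with h | ⟨s, hs, rfl⟩
    · exact h
    · rcases hp' j _ hj with h | ⟨t, ht, h⟩
      · exact h
      · exact (hdisj i j hij s t hs ht h).elim

/-- `g` runs periodically around a cycle of length `L`. -/
structure IsCyclicTrace {V : Type*} (G : SimpleGraph V) (L : ℕ) (g : ℕ → V) : Prop where
  three_le : 3 ≤ L
  adj : ∀ t, G.Adj (g t) (g (t + 1))
  eq_iff : ∀ s t, g s = g t ↔ s ≡ t [MOD L]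

/-! ### Cycles as periodic sequences, and rerouting. -/

section Trace

variable {V : Type*} {G : SimpleGraph V} {L : ℕ} {g : ℕ → V}

lemma exists_cyclicTrace {u : V} {c : G.Walk u u} (hc : c.IsCycle) :
    ∃ g, IsCyclicTrace G c.length g ∧ ∀ v, v ∈ c.support ↔ ∃ t, g t = v := by
  have h3 := hc.three_le_length
  refine ⟨fun t => c.getVert (t % c.length), ⟨h3, fun t => ?_, fun s t => ?_⟩, fun v => ?_⟩
  · have hlt : t % c.length < c.length := Nat.mod_lt _ (by omega)
    have hadj := c.adj_getVert_succ hlt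
    suffices c.getVert ((t + 1) % c.length) = c.getVert (t % c.length + 1) by rwa [this]
    rw [Nat.add_mod, Nat.mod_eq_of_lt (show 1 < c.length by omega)]
    rcases (show t % c.length + 1 ≤ c.length from hlt).lt_or_eq with h | h
    · rw [Nat.mod_eq_of_lt h]
    · rw [h, Nat.mod_self, c.getVert_zero, c.getVert_length]
  · have hs : s % c.length < c.length := Nat.mod_lt _ (by omega)
    have ht : t % c.length < c.length := Nat.mod_lt _ (by omega)
    exact ⟨fun h => hc.getVert_injOn' (Nat.le_sub_one_of_lt hs) (Nat.le_sub_one_of_lt ht) h,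
      fun h => congrArg c.getVert h⟩
  · rw [SimpleGraph.Walk.mem_support_iff_exists_getVert]
    constructor
    · rintro ⟨t, rfl, ht⟩
      rcases ht.lt_or_eq with h | h
      · exact ⟨t, congrArg c.getVert (Nat.mod_eq_of_lt h)⟩
      · exact ⟨0, by simp [h]⟩
    · rintro ⟨t, rfl⟩
      exact ⟨_, rfl, (Nat.mod_lt _ (by omega)).le⟩

lemma IsCyclicTrace.exists_walk (hg : IsCyclicTrace G L g) (s l : ℕ) :
    ∃ p : G.Walk (g s) (g (s + l)), p.length = l ∧ p.support = (List.range' s (l + 1)).map g := by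
  induction l generalizing s with
  | zero => exact ⟨.nil, by simp⟩
  | succ l ih =>
    obtain ⟨p, hl, hp⟩ := ih (s + 1)
    refine ⟨.cons (hg.adj s) (p.copy rfl (by rw [add_right_comm, add_assoc])), by simp [hl], ?_⟩
    rw [SimpleGraph.Walk.support_cons, SimpleGraph.Walk.support_copy, hp, List.range'_succ (n := l + 1),
      List.map_cons]

lemma IsCyclicTrace.nodup_map (hg : IsCyclicTrace G L g) (s l : ℕ) (hl : l ≤ L) :
    ((List.range' s l).map g).Nodup := by
  refine (List.nodup_map_iff_inj_on List.nodup_range').2 fun a ha b hb hab => ?_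
  rw [List.mem_range'_1] at ha hb
  rw [hg.eq_iff] at hab
  rcases le_total a b with h | h
  · have := Nat.eq_zero_of_dvd_of_lt ((Nat.modEq_iff_dvd' h).1 hab) (by omega)
    omega
  · have := Nat.eq_zero_of_dvd_of_lt ((Nat.modEq_iff_dvd' h).1 hab.symm) (by omega)
    omega

lemma IsCyclicTrace.exists_cycle (hg : IsCyclicTrace G L g) :
    ∃ c : G.Walk (g 0) (g 0), c.IsCycle ∧ c.length = L := by
  have h3 := hg.three_le
  obtain ⟨p, hl, hp⟩ := hg.exists_walk 0 L
  have h0 : g (0 + L) = g 0 := (hg.eq_iff _ _).2 (by simp [Nat.ModEq])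
  have hs : (p.copy rfl h0).support = (List.range' 0 (L + 1)).map g := by
    rw [SimpleGraph.Walk.support_copy, hp]
  have hlen : (p.copy rfl h0).length = L := by rw [SimpleGraph.Walk.length_copy, hl]
  refine ⟨p.copy rfl h0, ?_, hlen⟩
  rw [SimpleGraph.Walk.isCycle_iff_isPath_tail_and_le_length, hlen]
  refine ⟨?_, h3⟩
  rw [SimpleGraph.Walk.isPath_def, SimpleGraph.Walk.support_tail_of_not_nil, hs, List.range'_succ,
    List.map_cons, List.tail_cons]
  · exact hg.nodup_map _ _ le_rfl
  · rw [SimpleGraph.Walk.not_nil_iff_lt_length, hlen]; omega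

/-- Reroute a cycle between two vertices at distance `d` along it. -/
lemma IsCyclicTrace.exists_reroute (hg : IsCyclicTrace G L g) {a d : ℕ} (hd : 0 < d) (hdL : d < L)
    {q : G.Walk (g a) (g (a + d))} (hq : q.IsPath) (hq2 : 2 ≤ q.length)
    (hdisj : ∀ w ∈ q.support, (∃ t, g t = w) → w = g a ∨ w = g (a + d)) :
    ∃ c : G.Walk (g a) (g a), c.IsCycle ∧ c.length = q.length + (L - d) ∧
      ∀ w ∈ q.support, w ∈ c.support := by
  obtain ⟨p, hl, hp⟩ := hg.exists_walk (a + d) (L - d)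
  have h0 : g (a + d + (L - d)) = g a := (hg.eq_iff _ _).2 (by
    rw [show a + d + (L - d) = a + L by omega]; simp [Nat.ModEq])
  have hpath : (p.copy rfl h0).IsPath := by
    rw [SimpleGraph.Walk.isPath_copy, SimpleGraph.Walk.isPath_def, hp]
    exact hg.nodup_map _ _ (by omega)
  refine ⟨q.append (p.copy rfl h0), hq.isCycle_append hpath ?_ (Or.inl hq2), by simp [hl],
    fun w hw => SimpleGraph.Walk.mem_support_append_iff _ _ |>.2 (Or.inl hw)⟩
  intro w hwq hwp
  have hwp' : w ∈ (p.copy rfl h0).support := List.mem_of_mem_tail hwp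
  rw [SimpleGraph.Walk.support_copy, hp, List.mem_map] at hwp'
  obtain ⟨t, -, ht⟩ := hwp'
  have hq' := hq.support_nodup
  have hp' := hpath.support_nodup
  rw [← SimpleGraph.Walk.cons_tail_support, List.nodup_cons] at hq' hp'
  rcases hdisj w (List.mem_of_mem_tail hwq) ⟨t, ht⟩ with h | h
  · exact hq'.1 (h ▸ hwq)
  · exact hp'.1 (h ▸ hwp)

end Trace

/-! ### The lower bound. -/

section LowerBound

variable {V : Type*} [Fintype V] {G : SimpleGraph V} {k : ℕ}

/-- Some vertex `v` has two neighbours, and these are still joined by a path after `v` is deleted.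
-/
lemma IsKConnected.exists_cycle (hG : IsKConnected G k) (hk : 2 ≤ k) :
    ∃ (u : V) (c : G.Walk u u), c.IsCycle := by
  classical
  have hcard := hG.1
  have key (S : Finset V) (hS : S.card < k) {x y : V} (hx : x ∉ S) (hy : y ∉ S) :
      ∃ p : G.Walk x y, p.IsPath ∧ ∀ w ∈ p.support, w ∉ S := by
    obtain ⟨p⟩ := (hG.2 S hS).preconnected ⟨x, hx⟩ ⟨y, hy⟩
    let q : G.Walk x y := p.map (SimpleGraph.Embedding.induce _).toHom
    refine ⟨q.bypass, q.bypass_isPath, fun w hw => ?_⟩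
    have := q.support_bypass_subset_support hw
    rw [show q.support = _ from SimpleGraph.Walk.support_map _ p, List.mem_map] at this
    obtain ⟨z, -, rfl⟩ := this
    exact z.2
  have nbr (v : V) (S : Finset V) (hS : S.card < 2) (hv : v ∉ S) : ∃ w ∉ S, G.Adj v w := by
    obtain ⟨y, -, hy⟩ := Finset.exists_mem_notMem_of_card_lt_card
      (show (insert v S).card < (Finset.univ : Finset V).card by
        have := Finset.card_insert_le v S
        rw [Finset.card_univ]; omega)
    simp only [Finset.mem_insert, not_or] at hy
    obtain ⟨p, -, hp⟩ := key S (by omega) hv hy.2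
    cases p with
    | nil => exact (hy.1 rfl).elim
    | cons h p => exact ⟨_, hp _ (by simp), h⟩
  have : Nonempty V := Fintype.card_pos_iff.1 (by omega)
  obtain ⟨v⟩ := this
  obtain ⟨a, -, ha⟩ := nbr v ∅ (by simp) (by simp)
  obtain ⟨b, hb, hvb⟩ := nbr v {a} (by simp) (by simpa using ha.ne)
  obtain ⟨p, hp, hpv⟩ := key {v} (by simpa using by omega) (x := a) (y := b)
    (by simpa using ha.ne') (by simpa using hvb.ne')
  rw [Finset.mem_singleton] at hb
  have hvp : v ∉ p.support := fun h => hpv v h (by simp)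
  refine ⟨v, .cons ha (p.concat hvb.symm), (SimpleGraph.Walk.cons_isCycle_iff _ _).2
    ⟨hp.concat hvp _, fun h => ?_⟩⟩
  rw [SimpleGraph.Walk.edges_concat, List.concat_eq_append, List.mem_append, List.mem_singleton] at h
  rcases h with h | h
  · exact hvp (p.fst_mem_support_of_mem_edges h)
  · simp only [Sym2.eq_iff] at h
    rcases h with h | h
    · exact hvb.ne h.1
    · exact hb h.2.symm

lemma exists_cummerbund (h : ∃ (u : V) (c : G.Walk u u), c.IsCycle) :
    ∃ (u : V) (c : G.Walk u u), IsCummerbund G c := by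
  classical
  let P (l : ℕ) : Prop := ∃ (u : V) (c : G.Walk u u), c.IsCycle ∧ c.length = l
  have hb (l) (hl : P l) : l ≤ Fintype.card V := by
    obtain ⟨u, c, hc, rfl⟩ := hl
    have := hc.support_nodup.length_le_card
    simpa using this
  obtain ⟨u, c, hc⟩ := h
  have hP : P c.length := ⟨u, c, hc, rfl⟩
  obtain ⟨w, d, hd, hdl⟩ := Nat.findGreatest_spec (hb _ hP) hP
  exact ⟨w, d, hd, fun x e he => hdl ▸ Nat.le_findGreatest (hb _ ⟨x, e, he, rfl⟩) ⟨x, e, he, rfl⟩⟩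

/-- A vertex missed by every longest cycle forces the longest cycles to have length at least `3k`. -/
theorem IsKConnected.three_mul_le_length (hG : IsKConnected G k) {u : V}
    {c : G.Walk u u} (hc : IsCummerbund G c) {v : V}
    (hv : ∀ (w : V) (d : G.Walk w w), IsCummerbund G d → v ∉ d.support) :
    3 * k ≤ c.length := by
  classical
  obtain ⟨g, hg, hgc⟩ := exists_cyclicTrace hc.1
  have h3 := hg.three_le
  set L := c.length with hL
  have hcard : c.support.toFinset.card = L := by
    have : c.support.toFinset = c.support.tail.toFinset := by
      ext w
      simp only [List.mem_toFinset]
      refine ⟨fun h => ?_, List.mem_of_mem_tail⟩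
      rcases (c.mem_support_iff).1 h with rfl | h
      · exact c.end_mem_tail_support hc.1.not_nil
      · exact h
    rw [this, List.toFinset_card_of_nodup hc.1.support_nodup]
    simp [hL]
  have hvc : v ∉ c.support.toFinset := by simpa using hv u c hc
  -- The fan needs `m ≤ L`. In the end `3 * m ≤ L` with `L ≥ 3` excludes `m = L`, so `m = k`.
  obtain ⟨m, hm⟩ : ∃ m, m = min k L := ⟨_, rfl⟩
  obtain ⟨x, p, hp, hxC, hpC, hpp⟩ := hG.exists_fan hvc (m := m) (by omega) (by omega)
  simp only [List.mem_toFinset, hgc] at hxC hpC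
  have hvg : ¬ ∃ t, g t = v := by rwa [List.mem_toFinset, hgc] at hvc
  choose a ha using hxC
  -- Distinct ends are never within two steps along the cycle.
  have far (i j : Fin m) (d : ℕ) (hd : d < 3) (h : a j ≡ a i + d [MOD L]) : i = j ∧ d = 0 := by
    by_cases hij : i = j
    · subst hij
      refine ⟨rfl, ?_⟩
      have : L ∣ d := by
        have := (Nat.modEq_iff_dvd' (Nat.le_add_right _ _)).1 h
        simpa using this
      exact Nat.eq_zero_of_dvd_of_lt this (by omega)
    have hx : x i ≠ x j := fun h => hvg ⟨a i, (ha i).trans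
      (hpp i j hij _ (p i).end_mem_support (by rw [h]; exact (p j).end_mem_support))⟩
    have hxj : x j = g (a i + d) := by rw [← ha, hg.eq_iff]; exact h
    rcases Nat.eq_zero_or_pos d with rfl | hd0
    · exact (hx (by rw [hxj, ← ha i, add_zero])).elim
    exfalso
    let q : G.Walk (x i) (x j) := (p i).reverse.append (p j)
    have hsupp (w) : w ∈ q.support ↔ w ∈ (p i).support ∨ w ∈ (p j).support := by
      simp [q, SimpleGraph.Walk.mem_support_append_iff]
    have hpos (i) : 0 < (p i).length := by
      refine Nat.pos_of_ne_zero fun h => hvg ⟨a i, ?_⟩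
      rw [ha, SimpleGraph.Walk.eq_of_length_eq_zero h]
    have hqlen : 2 ≤ q.length := by
      have := hpos i
      have := hpos j
      simp only [q, SimpleGraph.Walk.length_append, SimpleGraph.Walk.length_reverse]
      omega
    have hqp : q.IsPath := by
      rw [SimpleGraph.Walk.isPath_def, SimpleGraph.Walk.support_append, List.nodup_append']
      refine ⟨(hp i).reverse.support_nodup, (hp j).support_nodup.tail, fun w hw hw' => ?_⟩
      rw [SimpleGraph.Walk.support_reverse, List.mem_reverse] at hw
      have hwv := hpp i j hij w hw (List.mem_of_mem_tail hw')
      have := (hp j).support_nodup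
      rw [← SimpleGraph.Walk.cons_tail_support, List.nodup_cons] at this
      exact this.1 (hwv ▸ hw')
    obtain ⟨e, he, hel, hes⟩ := hg.exists_reroute (q := q.copy (ha i).symm hxj) hd0 (by omega)
      (by simpa using hqp) (by simpa using hqlen) (by
        intro w hw hwt
        rw [SimpleGraph.Walk.support_copy, hsupp] at hw
        rw [← hxj, ha]
        exact hw.imp (fun h => hpC i w h hwt) fun h => hpC j w h hwt)
    have hve : v ∈ e.support := hes v (by
      rw [SimpleGraph.Walk.support_copy, hsupp]
      exact Or.inl (p i).start_mem_support)
    rw [SimpleGraph.Walk.length_copy] at hel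
    refine hv _ e ⟨he, fun w f hf => (hc.2 w f hf).trans ?_⟩ hve
    omega
  -- Hence the blocks of three positions starting at the ends are disjoint, which gives `3 * m ≤ L`.
  have hinj : Function.Injective fun z : Fin m × Fin 3 =>
      (⟨(a z.1 + z.2) % L, Nat.mod_lt _ (by omega)⟩ : Fin L) := by
    rintro ⟨i, s⟩ ⟨j, t⟩ hst
    have hst : a i + s ≡ a j + t [MOD L] := congrArg Fin.val hst
    rcases le_total s.1 t.1 with h | h
    · have := far j i (t - s) (by omega) (Nat.ModEq.add_right_cancel' s.1 (by
        rwa [add_assoc, Nat.sub_add_cancel h]))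
      exact Prod.ext this.1.symm (Fin.ext (by simp only; omega))
    · have := far i j (s - t) (by omega) (Nat.ModEq.add_right_cancel' t.1 (by
        rw [add_assoc, Nat.sub_add_cancel h]; exact hst.symm))
      exact Prod.ext this.1 (Fin.ext (by simp only; omega))
  have := Fintype.card_le_of_injective _ hinj
  simp only [Fintype.card_prod, Fintype.card_fin] at this
  omega

lemma length_le_cc {u : V} {c : G.Walk u u} (hc : IsCummerbund G c) : c.length ≤ cc G := by
  classical
  have hsub : (c.support.tail.toFinset : Set V) ⊆
      {v : V | ∃ (u : V) (c : G.Walk u u), IsCummerbund G c ∧ v ∈ c.support} := by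
    intro v hv
    exact ⟨u, c, hc, List.mem_of_mem_tail (by simpa using hv)⟩
  have := Set.ncard_le_ncard hsub (Set.toFinite _)
  rw [Set.ncard_coe_finset, List.toFinset_card_of_nodup hc.1.support_nodup] at this
  simpa [cc] using this

theorem IsKConnected.min_le_cc (hG : IsKConnected G k) (hk : 2 ≤ k) :
    min (Fintype.card V) (3 * k) ≤ cc G := by
  by_cases h : ∃ v, ∀ (w : V) (d : G.Walk w w), IsCummerbund G d → v ∉ d.support
  · obtain ⟨v, hv⟩ := h
    obtain ⟨u, c, hc⟩ := exists_cummerbund (hG.exists_cycle hk)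
    exact (min_le_right _ _).trans ((hG.three_mul_le_length hc hv).trans (length_le_cc hc))
  · push Not at h
    refine (min_le_left _ _).trans ?_
    rw [cc, Set.eq_univ_of_forall (s := {v | _}) h, Set.ncard_univ, Nat.card_eq_fintype_card]

lemma cc_le_card (G : SimpleGraph V) : cc G ≤ Fintype.card V := by
  rw [cc, ← Nat.card_eq_fintype_card]
  exact Set.ncard_le_card _

end LowerBound

/-! ### Invariance under isomorphism. -/

section Iso

variable {V W : Type*} {G : SimpleGraph V} {H : SimpleGraph W}

lemma IsCummerbund.map_iso (e : G ≃g H) {u : V} {c : G.Walk u u} (hc : IsCummerbund G c) :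
    IsCummerbund H (c.map e.toHom) := by
  refine ⟨(SimpleGraph.Walk.isCycle_map_iff_of_injective e.injective).2 hc.1, fun w d hd => ?_⟩
  have := hc.2 _ _ ((SimpleGraph.Walk.isCycle_map_iff_of_injective (f := e.symm.toHom)
    e.symm.injective).2 hd)
  simpa using this

lemma cc_le_of_iso [Finite W] (e : G ≃g H) : cc G ≤ cc H := by
  refine Set.ncard_le_ncard_of_injOn e ?_ e.injective.injOn (Set.toFinite _)
  rintro v ⟨u, c, hc, hv⟩
  refine ⟨_, _, hc.map_iso e, ?_⟩
  rw [SimpleGraph.Walk.support_map]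
  exact List.mem_map_of_mem hv

lemma cc_congr [Finite V] [Finite W] (e : G ≃g H) : cc G = cc H :=
  le_antisymm (cc_le_of_iso e) (cc_le_of_iso e.symm)

lemma IsKConnected.of_iso [Fintype V] [Fintype W] {k : ℕ} (e : G ≃g H) (hG : IsKConnected G k) :
    IsKConnected H k := by
  refine ⟨Fintype.card_congr e.toEquiv ▸ hG.1, fun S hS => ?_⟩
  let S' : Finset V := S.map e.symm.toEquiv.toEmbedding
  have hmem (x : V) : x ∈ S' ↔ e x ∈ S := by
    simp only [S', Finset.mem_map_equiv]
    rfl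
  let f : G.induce {v | v ∉ S'} →g H.induce {v | v ∉ S} :=
    ⟨fun x => ⟨e x.1, fun h => x.2 ((hmem _).2 h)⟩, fun h => e.map_adj_iff.2 h⟩
  refine (hG.2 S' (by simpa [S'] using hS)).map f fun y => ?_
  refine ⟨⟨e.symm y.1, fun h => y.2 ?_⟩, Subtype.ext (e.apply_symm_apply _)⟩
  simpa using (hmem _).1 h

end Iso

lemma isKConnected_top {V : Type*} [Fintype V] {k : ℕ} (h : k < Fintype.card V) :
    IsKConnected (⊤ : SimpleGraph V) k := by
  refine ⟨h, fun S hS => ?_⟩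
  obtain ⟨x, -, hx⟩ := Finset.exists_mem_notMem_of_card_lt_card
    (show S.card < (Finset.univ : Finset V).card by rw [Finset.card_univ]; omega)
  refine SimpleGraph.connected_iff_exists_forall_reachable _ |>.2 ⟨⟨x, hx⟩, fun y => ?_⟩
  by_cases hxy : (⟨x, hx⟩ : {v | v ∉ S}) = y
  · rw [hxy]
  · exact SimpleGraph.Adj.reachable (show x ≠ y.1 from fun h => hxy (Subtype.ext h))

/-- A closed trace that visits `A` in every three steps, and once after two steps, is shorter
than `3 #A`. -/
lemma IsCyclicTrace.length_lt {V : Type*} {G : SimpleGraph V} {L : ℕ} {g : ℕ → V}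
    (hg : IsCyclicTrace G L g) {A : Finset V}
    (hA : ∀ t, g t ∈ A ∨ g (t + 1) ∈ A ∨ g (t + 2) ∈ A) {s : ℕ} (hs : g s ∈ A)
    (hs2 : g (s + 2) ∈ A) : L < 3 * A.card := by
  classical
  have hex (t : ℕ) : ∃ e : Fin 3, g (t + e) ∈ A ∧ (g t ∈ A → e = 0) := by
    by_cases h : g t ∈ A
    · exact ⟨0, h, fun _ => rfl⟩
    · rcases hA t with h' | h' | h'
      · exact (h h').elim
      · exact ⟨1, h', fun h' => (h h').elim⟩
      · exact ⟨2, h', fun h' => (h h').elim⟩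
  choose e he he0 using hex
  have cancel {t t' d : ℕ} (h : g (t + d) = g (t' + d)) : t ≡ t' [MOD L] :=
    Nat.ModEq.add_right_cancel' d ((hg.eq_iff _ _).1 h)
  -- Sending a position to the next visit to `A` and its delay is injective. The pair `(g (s + 2),
  -- 2)` is missed: only position `s` could yield it, but there the delay is 0.
  have hlt := Fintype.card_lt_of_injective_of_notMem
    (fun t : Fin L => ((⟨g (t + e t), he t⟩, e t) : A × Fin 3)) (b := (⟨g (s + 2), hs2⟩, 2)) (by
      intro t t' h
      simp only [Prod.mk.injEq, Subtype.mk.injEq] at h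
      rw [h.2] at h
      have := cancel h.1
      exact Fin.ext (by rwa [Nat.ModEq, Nat.mod_eq_of_lt t.2, Nat.mod_eq_of_lt t'.2] at this)) (by
      rintro ⟨t, h⟩
      simp only [Prod.mk.injEq, Subtype.mk.injEq] at h
      have he2 := h.2
      rw [he2] at h
      have hts : g t = g s := (hg.eq_iff _ _).2 (cancel h.1)
      have := (he0 t (hts ▸ hs)).symm.trans he2
      simp at this)
  rw [Fintype.card_fin, Fintype.card_prod, Fintype.card_coe, Fintype.card_fin] at hlt
  omega

/-! ### The extremal graph. -/

section Extremal

variable {k s : ℕ}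

lemma extremalGraph_not_adj_inl (a b : Fin k × Fin 1) :
    ¬ (extremalGraph k s).Adj (.inl a) (.inl b) := by
  simp [extremalGraph, join, copies, Subsingleton.elim a.2 b.2]

lemma extremalGraph_adj_inl_inr (a : Fin k × Fin 1) (b : (Fin k × Fin 2) ⊕ (Fin s × Fin 1)) :
    (extremalGraph k s).Adj (.inl a) (.inr b) := by
  simp [extremalGraph, join]

lemma extremalGraph_adj_edge (a b : Fin k × Fin 2) :
    (extremalGraph k s).Adj (.inr (.inl a)) (.inr (.inl b)) ↔ a.1 = b.1 ∧ a.2 ≠ b.2 := by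
  simp [extremalGraph, join, copies]

lemma extremalGraph_not_adj_isolated (a : Fin s × Fin 1) (b : (Fin k × Fin 2) ⊕ (Fin s × Fin 1)) :
    ¬ (extremalGraph k s).Adj (.inr (.inr a)) (.inr b) := by
  rcases b with b | b
  · simp [extremalGraph, join, copies]
  · simp [extremalGraph, join, copies, Subsingleton.elim a.2 b.2]

/-- Fewer than `k` deletions spare a vertex on each side of the join, and these two link all
survivors. -/
lemma isKConnected_extremalGraph (hk : 0 < k) : IsKConnected (extremalGraph k s) k := by
  classical
  refine ⟨by simp; omega, fun S hS => ?_⟩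
  have free (f : Fin k → (Fin k × Fin 1) ⊕ ((Fin k × Fin 2) ⊕ (Fin s × Fin 1)))
      (hf : Function.Injective f) : ∃ i, f i ∉ S := by
    obtain ⟨x, hx, hxS⟩ := Finset.exists_mem_notMem_of_card_lt_card
      (show S.card < (Finset.univ.image f).card by
        rwa [Finset.card_image_of_injective _ hf, Finset.card_univ, Fintype.card_fin])
    obtain ⟨i, -, rfl⟩ := Finset.mem_image.1 hx
    exact ⟨i, hxS⟩
  obtain ⟨i, hi⟩ := free (fun i => .inl (i, 0)) fun i j h => by simpa using h
  obtain ⟨j, hj⟩ := free (fun i => .inr (.inl (i, 0))) fun i j h => by simpa using h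
  have hadj {a} {b} (ha : Sum.inl a ∉ S) (hb : Sum.inr b ∉ S) :
      ((extremalGraph k s).induce {v | v ∉ S}).Reachable ⟨_, ha⟩ ⟨_, hb⟩ :=
    SimpleGraph.Adj.reachable (extremalGraph_adj_inl_inr a b)
  refine SimpleGraph.connected_iff_exists_forall_reachable _ |>.2 ⟨⟨_, hi⟩, ?_⟩
  rintro ⟨a | b, h⟩
  · exact (hadj hi hj).trans (hadj h hj).symm
  · exact hadj hi h

lemma exists_cycle_extremalGraph (hk : 2 ≤ k) :
    ∃ (u : _) (c : (extremalGraph k s).Walk u u), c.IsCycle ∧ c.length = 3 * k := by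
  -- The cycle repeats the pattern: vertex of A, then both ends of an edge. The residue `t % 3`
  -- selects the place in the pattern and `t / 3 % k` the block.
  let F (r : ℕ) (i : Fin k) : (Fin k × Fin 1) ⊕ ((Fin k × Fin 2) ⊕ (Fin s × Fin 1)) :=
    if r = 0 then .inl (i, 0) else if r = 1 then .inr (.inl (i, 0)) else .inr (.inl (i, 1))
  let q (t : ℕ) : Fin k := ⟨t / 3 % k, Nat.mod_lt _ (by omega)⟩
  have hq (t : ℕ) : (q t).1 = t % (3 * k) / 3 := (Nat.mod_mul_right_div_self t 3 k).symm
  have hF {r r' : ℕ} (hr : r < 3) (hr' : r' < 3) {i i' : Fin k} (h : F r i = F r' i') :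
      r = r' ∧ i = i' := by
    interval_cases r <;> interval_cases r' <;> simp_all [F]
  have htr : IsCyclicTrace (extremalGraph k s) (3 * k) fun t => F (t % 3) (q t) := by
    refine ⟨by omega, fun t => ?_, fun s t => ⟨fun h => ?_, fun h => ?_⟩⟩
    · have h3 : t % 3 < 3 := Nat.mod_lt _ (by omega)
      have hqq (h : t % 3 ≠ 2) : q (t + 1) = q t := by
        simp only [q, show (t + 1) / 3 = t / 3 by omega]
      obtain h | h | h : t % 3 = 0 ∨ t % 3 = 1 ∨ t % 3 = 2 := by omega
      · simp only [hqq (by omega), h, show (t + 1) % 3 = 1 by omega]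
        exact extremalGraph_adj_inl_inr _ _
      · simp only [hqq (by omega), h, show (t + 1) % 3 = 2 by omega]
        exact (extremalGraph_adj_edge _ _).2 ⟨rfl, by simp⟩
      · simp only [h, show (t + 1) % 3 = 0 by omega]
        exact (extremalGraph_adj_inl_inr _ _).symm
    · obtain ⟨h1, h2⟩ := hF (Nat.mod_lt _ (by omega)) (Nat.mod_lt _ (by omega)) h
      have h2 : s / 3 ≡ t / 3 [MOD k] := congrArg Fin.val h2
      have := (h2.mul_left' 3).add_right (s % 3)
      rw [Nat.div_add_mod, h1, Nat.div_add_mod] at this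
      exact this
    · have h1 : s % 3 = t % 3 := h.of_mul_right k
      have h2 : q s = q t := Fin.ext (by rw [hq, hq, h])
      simp only [h1, h2]
  obtain ⟨c, hc, hl⟩ := htr.exists_cycle
  exact ⟨_, c, hc, hl⟩

lemma extremalGraph_cycle_length_lt {u : _} {c : (extremalGraph k s).Walk u u} (hc : c.IsCycle)
    {w : Fin s × Fin 1} (hw : .inr (.inr w) ∈ c.support) : c.length < 3 * k := by
  classical
  obtain ⟨g, hg, hgc⟩ := exists_cyclicTrace hc
  have h3 := hg.three_le
  obtain ⟨t, ht⟩ := (hgc _).1 hw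
  have hA (v) : v ∈ (Finset.univ.map ⟨Sum.inl, Sum.inl_injective⟩ :
      Finset ((Fin k × Fin 1) ⊕ ((Fin k × Fin 2) ⊕ (Fin s × Fin 1)))) ↔ ∃ a, Sum.inl a = v := by
    simp
  have nbr {t : ℕ} {y} (hy : g t = .inr (.inr w)) (h : (extremalGraph k s).Adj (g t) y) :
      ∃ a, Sum.inl a = y := by
    rcases y with a | b
    · exact ⟨a, rfl⟩
    · rw [hy] at h
      exact (extremalGraph_not_adj_isolated w b h).elim
  -- The predecessor of position `t` is written `t + (c.length - 1)`, since `t` may be 0.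
  have htL : g (t + (c.length - 1) + 1) = .inr (.inr w) := by
    rw [← ht, hg.eq_iff, show t + (c.length - 1) + 1 = t + c.length by omega]
    simp [Nat.ModEq]
  have := hg.length_lt (A := Finset.univ.map ⟨Sum.inl, Sum.inl_injective⟩) (s := t + (c.length - 1))
    (fun t => ?_) ((hA _).2 (nbr htL (hg.adj _).symm)) ((hA _).2 (nbr htL (hg.adj _)))
  · simpa using this
  · simp only [hA]
    have h1 := hg.adj t
    have h2 := hg.adj (t + 1)
    have hne : g t ≠ g (t + 2) := by
      rw [Ne, hg.eq_iff, Nat.modEq_iff_dvd' (Nat.le_add_right _ _), Nat.add_sub_cancel_left]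
      exact fun h => by have := Nat.le_of_dvd (by omega) h; omega
    -- Three consecutive vertices outside A would lie in one copy of K₂, so the first and third
    -- would coincide.
    by_contra! hcon
    rcases hx : g t with a | a | a
    · exact hcon.1 a hx.symm
    · rcases hy : g (t + 1) with b | b | b
      · exact hcon.2.1 b hy.symm
      · rcases hz : g (t + 2) with d | d | d
        · exact hcon.2.2 d hz.symm
        · rw [hx, hy, extremalGraph_adj_edge] at h1
          rw [hy, hz, extremalGraph_adj_edge] at h2
          have had : a = d := Prod.ext (h1.1.trans h2.1) (by omega)
          rw [hx, hz, had] at hne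
          exact hne rfl
        · rw [hy, hz] at h2
          exact extremalGraph_not_adj_isolated _ _ h2.symm
      · rw [hx, hy] at h1
        exact extremalGraph_not_adj_isolated _ _ h1.symm
    · rcases hy : g (t + 1) with b | b
      · exact hcon.2.1 b hy.symm
      · rw [hx, hy] at h1
        exact extremalGraph_not_adj_isolated _ _ h1

lemma cc_extremalGraph (hk : 2 ≤ k) : cc (extremalGraph k s) = 3 * k := by
  refine le_antisymm ?_ ?_
  · obtain ⟨u, c, hc, hl⟩ := exists_cycle_extremalGraph (s := s) hk
    have hsub : {v | ∃ (u : _) (c : (extremalGraph k s).Walk u u),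
        IsCummerbund _ c ∧ v ∈ c.support} ⊆ Set.range
          (Sum.map id Sum.inl : (Fin k × Fin 1) ⊕ (Fin k × Fin 2) → _) := by
      rintro (a | b | w) ⟨u', d, hd, hv⟩
      · exact ⟨.inl a, rfl⟩
      · exact ⟨.inr b, rfl⟩
      · have := extremalGraph_cycle_length_lt hd.1 hv
        have := hd.2 _ c hc
        omega
    refine (Set.ncard_le_ncard hsub (Set.toFinite _)).trans ?_
    rw [← Set.image_univ]
    refine (Set.ncard_image_le (Set.toFinite _)).trans ?_
    rw [Set.ncard_univ, Nat.card_eq_fintype_card]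
    simp only [Fintype.card_sum, Fintype.card_prod, Fintype.card_fin]
    omega
  · have := (isKConnected_extremalGraph (s := s) (show 0 < k by omega)).min_le_cc hk
    simp only [Fintype.card_sum, Fintype.card_prod, Fintype.card_fin] at this
    omega

end Extremal

end Cummerbund

theorem theorem7 (k n : ℕ) (hk : 2 ≤ k) (hn : k < n) :
    IsLeast {m : ℕ | ∃ (V : Type u) (_ : Fintype V) (G : SimpleGraph V),
      Fintype.card V = n ∧ Cummerbund.IsKConnected G k ∧ Cummerbund.cc G = m} (min n (3 * k)) ∧
    (3 * k < n →
      Fintype.card ((Fin k × Fin 1) ⊕ ((Fin k × Fin 2) ⊕ (Fin (n - 3 * k) × Fin 1))) = n ∧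
      Cummerbund.IsKConnected (Cummerbund.extremalGraph k (n - 3 * k)) k ∧
      Cummerbund.cc (Cummerbund.extremalGraph k (n - 3 * k)) = min n (3 * k)) := by
  open Cummerbund in
  have hext : 3 * k < n →
      Fintype.card ((Fin k × Fin 1) ⊕ ((Fin k × Fin 2) ⊕ (Fin (n - 3 * k) × Fin 1))) = n ∧
      IsKConnected (extremalGraph k (n - 3 * k)) k ∧
      cc (extremalGraph k (n - 3 * k)) = min n (3 * k) := fun h =>
    ⟨by simp only [Fintype.card_sum, Fintype.card_prod, Fintype.card_fin]; omega,
      isKConnected_extremalGraph (by omega), by rw [cc_extremalGraph hk, min_eq_right h.le]⟩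
  refine ⟨⟨?_, ?_⟩, hext⟩
  · rcases le_or_gt n (3 * k) with h | h
    · have hcard : Fintype.card (ULift.{u} (Fin n)) = n := by simp
      have htop : Cummerbund.IsKConnected (⊤ : SimpleGraph (ULift.{u} (Fin n))) k :=
        Cummerbund.isKConnected_top (by rwa [hcard])
      refine ⟨ULift.{u} (Fin n), inferInstance, ⊤, hcard, htop, le_antisymm ?_ ?_⟩
      · rw [min_eq_left h]
        exact (Cummerbund.cc_le_card _).trans hcard.le
      · simpa only [hcard] using htop.min_le_cc hk
    · obtain ⟨h1, h2, h3⟩ := hext h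
      let e := SimpleGraph.Iso.map (Equiv.ulift.{u}.symm)
        (Cummerbund.extremalGraph k (n - 3 * k))
      exact ⟨_, inferInstance, _, (Fintype.card_congr e.toEquiv).symm.trans h1, h2.of_iso e,
        (Cummerbund.cc_congr e).symm.trans h3⟩
  · rintro m ⟨V, _, G, hV, hG, rfl⟩
    simpa only [hV] using hG.min_le_cc hk
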